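/- **Lemma 4.1 (connection 1-forms, odd dimensions).** Let $(M,g)$ be a smooth Riemannian manifold of odd dimension $D=2n+1$ with Levi-Civita connection $\nabla$, and let $T$ be a smooth 3-form on $M$. Let $\nabla^T$ be the connection $$\nabla^T_XY=\nabla_XY+\tfrac12\sum_a T(X,Y,e_a)\,e_a$$ (sum over an orthonormal basis), extended to forms as a derivation, and put $d^T\Psi=\sum_a e^a\wedge\nabla^T_{e_a}\Psi$ and $\delta^T\Psi=-\sum_a e_a\lrcorner\nabla^T_{e_a}\Psi$. Let $h$ be a principal Killing–Yano tensor with torsion, that is, a smooth 2-form such that * $h$ is a $d^T$-closed generalized conformal Killing–Yano tensor: $d^Th=0$ and $\nabla^T_Xh=\frac13X\lrcorner d^Th-\frac1{D-1}X^\flat\wedge\delta^Th$ for every vector field $X$; * $h$ is non-degenerate: as a $(1,1)$-tensor it has maximal rank $2n$ at every point, and its eigenvalues $\pm i x_\mu$ $(\mu=1,\dots,n)$ are given locally by smooth functions $x_\mu$, and any such functions $x_1,\dots,x_n$ on an open set have linearly independent differentials at every point of it. Let $\xi=-\frac1{D-1}\delta^Th$ be the associated 1-form. Let $\{e_\mu,e_{\hat\mu},e_0\}_{\mu=1,\dots,n}$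 be a canonical frame on an open set $U\subseteq M$, i.e. a smooth orthonormal frame with dual coframe $\{e^\mu,e^{\hat\mu},e^0\}$ in which $$h=\sum_{\mu=1}^n x_\mu\,e^\mu\wedge e^{\hat\mu},\qquad \xi=\sum_{\mu=1}^n\sqrt{Q_\mu}\,e^{\hat\mu}+\sqrt{Q_0}\,e^0$$ on $U$, with functions $Q_\mu\ge0$ and $Q_0\ge 0$, and assume that $Q_0\neq0$ on $U$. Let the connection 1-forms $\omega^a{}_b$ be defined by $\nabla^T_Xe_b=\sum_a\omega^a{}_b(X)\,e_a$, and put $\kappa_a{}^b=(e^b)_c\nabla^T_a\xi^c=(\nabla^T_{e_a}\xi)(e_b)$. Then, at every point of $U$, $Q_\mu\ne0$ and $x_\mu\neq0$ for all $\mu$, $x_\mu^2\ne x_\nu^2$ for $\mu\neq\nu$, and $$\begin{aligned} \omega^\mu{}_\nu&=-\frac{x_\nu\sqrt{Q_\nu}}{x_\mu^2-x_\nu^2}\,e^\mu-\frac{x_\mu\sqrt{Q_\mu}}{x_\mu^2-x_\nu^2}\,e^\nu &&(\mu\ne\nu),\\ \omega^\mu{}_{\hat\mu}&=-\frac1{\sqrt{Q_\mu}}\Big(\sum_{\nu\ne\mu}\frac{x_\mu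 Q_\nu}{x_\mu^2-x_\nu^2}+\frac{Q_0}{x_\mu}\Big)e^{\hat\mu}+\sum_{\nu\neq\mu}\frac{x_\mu\sqrt{Q_\nu}}{x_\mu^2-x_\nu^2}\,e^{\hat\nu}+\frac{\sqrt{Q_0}}{x_\mu}\,e^0+\sum_a\frac{\kappa_a{}^\mu}{\sqrt{Q_\mu}}\,e^a,\\ \omega^\mu{}_{\hat\nu}&=\frac{x_\mu\sqrt{Q_\nu}}{x_\mu^2-x_\nu^2}\,e^{\hat\mu}-\frac{x_\mu\sqrt{Q_\mu}}{x_\mu^2-x_\nu^2}\,e^{\hat\nu} &&(\mu\neq\nu),\\ \omega^{\hat\mu}{}_{\hat\nu}&=-\frac{x_\mu\sqrt{Q_\nu}}{x_\mu^2-x_\nu^2}\,e^\mu-\frac{x_\nu\sqrt{Q_\mu}}{x_\mu^2-x_\nu^2}\,e^\nu &&(\mu\ne\nu),\\ \omega^\mu{}_0&=\frac{\sqrt{Q_0}}{x_\mu}\,e^{\hat\mu}-\frac{\sqrt{Q_\mu}}{x_\mu}\,e^0,\\ \omega^{\hat\mu}{}_0&=-\frac{\sqrt{Q_0}}{x_\mu}\,e^\mu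 . \end{aligned}$$ -/

import Mathlib

open Bundle
open scoped Manifold ContDiff

noncomputable section

namespace TorsionKY

/-! ### The Levi-Civita connection of a Riemannian manifold -/

section LeviCivita

set_option linter.unusedSectionVars false

variable {E : Type*} [NormedAddCommGroup E] [NormedSpace ℝ E] [FiniteDimensional ℝ E]
  {H : Type*} [TopologicalSpace H] {I : ModelWithCorners ℝ E H}
  {M : Type*} [TopologicalSpace M] [ChartedSpace H M] [IsManifold I ∞ M]
  [RiemannianBundle (fun x : M => TangentSpace I x)]

/-- The right-hand side of the Koszul formula for `g(∇_X Y, Z)` at `x`. -/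
def koszul (Y X Z : Π x : M, TangentSpace I x) (x : M) : ℝ :=
  (1 / 2) * (mvfderiv I (fun y => inner ℝ (Y y) (Z y)) x (X x)
    + mvfderiv I (fun y => inner ℝ (X y) (Z y)) x (Y x)
    - mvfderiv I (fun y => inner ℝ (X y) (Y y)) x (Z x)
    + inner ℝ (VectorField.mlieBracket I X Y x) (Z x)
    - inner ℝ (VectorField.mlieBracket I X Z x) (Y x)
    - inner ℝ (VectorField.mlieBracket I Y Z x) (X x))

variable [IsContMDiffRiemannianBundle I ∞ E (fun x : M => TangentSpace I x)]

theorem mdiffAt_inner {X Y : Π x : M, TangentSpace I x} {x : M} (hX : MDiffAt (T% X) x)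
    (hY : MDiffAt (T% Y) x) : MDiffAt (fun y => inner ℝ (X y) (Y y)) x :=
  MDifferentiableAt.inner_bundle (IB := I) (F := E) (E := fun x : M => TangentSpace I x)
    (b := fun x => x) hX hY

theorem koszul_tensorial₁ {Y : Π x : M, TangentSpace I x} {x : M} (hY : MDiffAt (T% Y) x)
    (Z : Π x : M, TangentSpace I x) (hZ : MDiffAt (T% Z) x) :
    TensorialAt I E (fun X => koszul Y X Z x) x where
  smul {f X} hf hX := by
    have : CompleteSpace E := FiniteDimensional.complete ℝ E
    have h1 : MDiffAt (fun y => inner ℝ (X y) (Z y)) x := mdiffAt_inner hX hZ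
    have h2 : MDiffAt (fun y => inner ℝ (X y) (Y y)) x := mdiffAt_inner hX hY
    simp only [koszul, Pi.smul_apply', real_inner_smul_left, real_inner_smul_right, map_smul,
      VectorField.mlieBracket_smul_left hf hX, inner_add_left,
      mvfderiv_fun_mul hf h1, mvfderiv_fun_mul hf h2]
    simp
    rw [real_inner_comm (Y x) (X x), real_inner_comm (Z x) (X x)]
    ring
  add {X X'} hX hX' := by
    have : CompleteSpace E := FiniteDimensional.complete ℝ E
    have h1 : MDiffAt (fun y => inner ℝ (X y) (Z y)) x := mdiffAt_inner hX hZ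
    have h2 : MDiffAt (fun y => inner ℝ (X y) (Y y)) x := mdiffAt_inner hX hY
    have h1' : MDiffAt (fun y => inner ℝ (X' y) (Z y)) x := mdiffAt_inner hX' hZ
    have h2' : MDiffAt (fun y => inner ℝ (X' y) (Y y)) x := mdiffAt_inner hX' hY
    simp only [koszul, Pi.add_apply, inner_add_left, inner_add_right, map_add,
      VectorField.mlieBracket_add_left hX hX', 
      mvfderiv_fun_add h1 h1', mvfderiv_fun_add h2 h2']
    simp
    ring

theorem koszul_tensorial₂ {Y : Π x : M, TangentSpace I x} {x : M} (hY : MDiffAt (T% Y) x)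
    (X : Π x : M, TangentSpace I x) (hX : MDiffAt (T% X) x) :
    TensorialAt I E (fun Z => koszul Y X Z x) x where
  smul {f Z} hf hZ := by
    have : CompleteSpace E := FiniteDimensional.complete ℝ E
    have h1 : MDiffAt (fun y => inner ℝ (Y y) (Z y)) x := mdiffAt_inner hY hZ
    have h2 : MDiffAt (fun y => inner ℝ (X y) (Z y)) x := mdiffAt_inner hX hZ
    simp only [koszul, Pi.smul_apply', inner_smul_left, inner_smul_right, map_smul,
      VectorField.mlieBracket_smul_right hf hZ, inner_add_left,
      mvfderiv_fun_mul hf h1, mvfderiv_fun_mul hf h2]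
    simp
    rw [real_inner_comm (Y x) (Z x), real_inner_comm (X x) (Z x)]
    ring
  add {Z Z'} hZ hZ' := by
    have : CompleteSpace E := FiniteDimensional.complete ℝ E
    have h1 : MDiffAt (fun y => inner ℝ (Y y) (Z y)) x := mdiffAt_inner hY hZ
    have h2 : MDiffAt (fun y => inner ℝ (X y) (Z y)) x := mdiffAt_inner hX hZ
    have h1' : MDiffAt (fun y => inner ℝ (Y y) (Z' y)) x := mdiffAt_inner hY hZ'
    have h2' : MDiffAt (fun y => inner ℝ (X y) (Z' y)) x := mdiffAt_inner hX hZ'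
    simp only [koszul, Pi.add_apply, inner_add_left, inner_add_right, map_add,
      VectorField.mlieBracket_add_right hZ hZ',
      mvfderiv_fun_add h1 h1', mvfderiv_fun_add h2 h2']
    simp
    ring

/-- `g (∇_X Y) Z` as a bilinear form in the values of `X` and `Z` at `x`. -/
def koszulForm (Y : Π x : M, TangentSpace I x) (x : M) (hY : MDiffAt (T% Y) x) :
    TangentSpace I x →L[ℝ] TangentSpace I x →L[ℝ] ℝ :=
  TensorialAt.mkHom₂ (fun X Z => koszul Y X Z x) x
    (fun Z hZ => koszul_tensorial₁ hY Z hZ) (fun X hX => koszul_tensorial₂ hY X hX)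

theorem koszulForm_apply {Y : Π x : M, TangentSpace I x} {x : M} (hY : MDiffAt (T% Y) x)
    {X Z : Π x : M, TangentSpace I x} (hX : MDiffAt (T% X) x) (hZ : MDiffAt (T% Z) x) :
    koszulForm Y x hY (X x) (Z x) = koszul Y X Z x :=
  TensorialAt.mkHom₂_apply _ _ hX hZ

instance tangent_finiteDimensional (x : M) : FiniteDimensional ℝ (TangentSpace I x) :=
  inferInstanceAs (FiniteDimensional ℝ E)

open Classical in
/-- The Levi-Civita covariant derivative of a vector field `Y` at a point where `Y` is
differentiable (and `0` elsewhere), obtained from the Koszul formula. -/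
def leviCivitaFun (Y : Π x : M, TangentSpace I x) (x : M) :
    TangentSpace I x →L[ℝ] TangentSpace I x :=
  if hY : MDiffAt (T% Y) x then
    ∑ i, ((koszulForm Y x hY).flip (stdOrthonormalBasis ℝ (TangentSpace I x) i)).smulRight
      (stdOrthonormalBasis ℝ (TangentSpace I x) i)
  else 0

theorem inner_leviCivitaFun {Y : Π x : M, TangentSpace I x} {x : M} (hY : MDiffAt (T% Y) x)
    (v w : TangentSpace I x) :
    inner ℝ (leviCivitaFun Y x v) w = koszulForm Y x hY v w := by
  have hw := (stdOrthonormalBasis ℝ (TangentSpace I x)).sum_repr' w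
  conv_rhs => rw [← hw]
  simp [leviCivitaFun, hY, sum_inner, inner_smul_left, mul_comm]

theorem inner_leviCivitaFun_apply {Y : Π x : M, TangentSpace I x} {x : M}
    (hY : MDiffAt (T% Y) x)
    {X Z : Π x : M, TangentSpace I x} (hX : MDiffAt (T% X) x) (hZ : MDiffAt (T% Z) x) :
    inner ℝ (leviCivitaFun Y x (X x)) (Z x) = koszul Y X Z x := by
  rw [inner_leviCivitaFun hY, koszulForm_apply hY hX hZ]

theorem leviCivitaFun_isCovariantDerivativeOn :
    IsCovariantDerivativeOn (I := I) (M := M) E leviCivitaFun Set.univ where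
  add {Y Y' x} hY hY' _ := by
    have hs : MDiffAt (T% (Y + Y')) x := mdifferentiableAt_add_section hY hY'
    have : CompleteSpace E := FiniteDimensional.complete ℝ E
    ext v
    refine ext_inner_right ℝ fun w => ?_
    have hv : MDiffAt (T% (FiberBundle.extend E v)) x := FiberBundle.mdifferentiableAt_extend ..
    have hw : MDiffAt (T% (FiberBundle.extend E w)) x := FiberBundle.mdifferentiableAt_extend ..
    have e1 := inner_leviCivitaFun_apply hs hv hw
    have e2 := inner_leviCivitaFun_apply hY hv hw
    have e3 := inner_leviCivitaFun_apply hY' hv hw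
    rw [FiberBundle.extend_apply_self, FiberBundle.extend_apply_self] at e1 e2 e3
    rw [add_apply, inner_add_left, e1, e2, e3]
    simp only [koszul, Pi.add_apply, inner_add_left, inner_add_right, map_add,
      VectorField.mlieBracket_add_right hY hY', VectorField.mlieBracket_add_left hY hY',
      mvfderiv_fun_add (mdiffAt_inner hY hw) (mdiffAt_inner hY' hw),
      mvfderiv_fun_add (mdiffAt_inner hv hY) (mdiffAt_inner hv hY')]
    simp
    ring
  leibniz {Y f x} hY hf _ := by
    have hs : MDiffAt (T% (f • Y)) x := hf.smul_section hY
    have : CompleteSpace E := FiniteDimensional.complete ℝ E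
    ext v
    refine ext_inner_right ℝ fun w => ?_
    have hv : MDiffAt (T% (FiberBundle.extend E v)) x := FiberBundle.mdifferentiableAt_extend ..
    have hw : MDiffAt (T% (FiberBundle.extend E w)) x := FiberBundle.mdifferentiableAt_extend ..
    have e1 := inner_leviCivitaFun_apply hs hv hw
    have e2 := inner_leviCivitaFun_apply hY hv hw
    rw [FiberBundle.extend_apply_self, FiberBundle.extend_apply_self] at e1 e2
    rw [add_apply, inner_add_left, e1, smul_apply,
      real_inner_smul_left, e2]
    simp only [koszul, Pi.smul_apply', real_inner_smul_left, real_inner_smul_right, map_smul,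
      VectorField.mlieBracket_smul_right hf hY, VectorField.mlieBracket_smul_left hf hY,
      inner_add_left,
      mvfderiv_fun_mul hf (mdiffAt_inner hY hw),
      mvfderiv_fun_mul hf (mdiffAt_inner hv hY)]
    simp [real_inner_smul_left]
    rw [real_inner_comm (Y x) v]
    ring

/-- The Levi-Civita connection of the Riemannian metric on `M`; `leviCivita Y x v` is `∇_v Y`
at `x`. It is torsion-free and metric, see the two theorems below. -/
def leviCivita : CovariantDerivative I E (TangentSpace I : M → Type _) where
  toFun := leviCivitaFun
  isCovariantDerivativeOnUniv := leviCivitaFun_isCovariantDerivativeOn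

theorem leviCivita_torsion : (leviCivita (I := I) (M := M)).torsion = 0 := by
  have : CompleteSpace E := FiniteDimensional.complete ℝ E
  rw [CovariantDerivative.torsion_eq_zero_iff]
  intro X Y x hX hY
  refine ext_inner_right ℝ fun w => ?_
  have hw : MDiffAt (T% (FiberBundle.extend E w)) x := FiberBundle.mdifferentiableAt_extend ..
  have e1 := inner_leviCivitaFun_apply hY hX hw
  have e2 := inner_leviCivitaFun_apply hX hY hw
  rw [FiberBundle.extend_apply_self] at e1 e2
  change inner ℝ (leviCivitaFun Y x (X x) - leviCivitaFun X x (Y x)) w = _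
  rw [inner_sub_left, e1, e2]
  have h1 : (fun y => inner ℝ (X y) (Y y)) = fun y => inner ℝ (Y y) (X y) := by
    ext y; exact real_inner_comm _ _
  simp only [koszul, h1, VectorField.mlieBracket_swap_apply (V := Y) (W := X), inner_neg_left,
    FiberBundle.extend_apply_self]
  ring

theorem leviCivita_metric {X Y Z : Π x : M, TangentSpace I x} {x : M} (hX : MDiffAt (T% X) x)
    (hY : MDiffAt (T% Y) x) (hZ : MDiffAt (T% Z) x) :
    mvfderiv I (fun y => inner ℝ (Y y) (Z y)) x (X x) =
      inner ℝ (leviCivita Y x (X x)) (Z x) + inner ℝ (Y x) (leviCivita Z x (X x)) := by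
  change _ = inner ℝ (leviCivitaFun Y x (X x)) (Z x) + inner ℝ (Y x) (leviCivitaFun Z x (X x))
  rw [real_inner_comm _ (Y x), inner_leviCivitaFun_apply hY hX hZ,
    inner_leviCivitaFun_apply hZ hX hY]
  have h1 : (fun y => inner ℝ (Z y) (Y y)) = fun y => inner ℝ (Y y) (Z y) := by
    ext y; exact real_inner_comm _ _
  simp only [koszul, h1, VectorField.mlieBracket_swap_apply (V := Z) (W := Y), inner_neg_left]
  ring

end LeviCivita

/-! ### Forms, the connection with torsion, and generalized Killing-Yano tensors -/

section Forms

set_option linter.unusedSectionVars false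

variable {E : Type*} [NormedAddCommGroup E] [NormedSpace ℝ E] [FiniteDimensional ℝ E]
  {H : Type*} [TopologicalSpace H] (I : ModelWithCorners ℝ E H)
  (M : Type*) [TopologicalSpace M] [ChartedSpace H M]

/-- Fields of alternating `p`-forms on `M`. -/
abbrev FormField (p : ℕ) : Type _ := Π x : M, TangentSpace I x [⋀^Fin p]→L[ℝ] ℝ

/-- Fields of real-valued functions of `p` tangent vectors at the same point. -/
abbrev Cochain (p : ℕ) : Type _ := Π x : M, (Fin p → TangentSpace I x) → ℝ

variable {I M} {p : ℕ}

theorem FormField.add₀ (T : FormField I M 3) {x : M} (u u' v w : TangentSpace I x) :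
    T x ![u + u', v, w] = T x ![u, v, w] + T x ![u', v, w] := by
  have e (z : TangentSpace I x) : Function.update ![u, v, w] 0 z = ![z, v, w] := by
    funext i
    fin_cases i <;> rfl
  have h := (T x).map_update_add ![u, v, w] 0 u u'
  rw [e, e, e] at h
  exact h

theorem FormField.smul₀ (T : FormField I M 3) {x : M} (c : ℝ) (u v w : TangentSpace I x) :
    T x ![c • u, v, w] = c * T x ![u, v, w] := by
  have e (z : TangentSpace I x) : Function.update ![u, v, w] 0 z = ![z, v, w] := by
    funext i
    fin_cases i <;> rfl
  have h := (T x).map_update_smul ![u, v, w] 0 c u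
  rw [e, e] at h
  exact h

theorem FormField.swap₀₁ (T : FormField I M 3) {x : M} (u v w : TangentSpace I x) :
    T x ![u, v, w] = -T x ![v, u, w] := by
  have e : ![u, v, w] = ![v, u, w] ∘ Equiv.swap 0 1 := by
    funext i
    fin_cases i <;> rfl
  rw [e]
  exact (T x).toAlternatingMap.map_swap ![v, u, w] (by decide)

/-- The underlying functions of a field of alternating forms. -/
def FormField.toCochain (Ψ : FormField I M p) : Cochain I M p := fun x w => Ψ x w

variable [IsManifold I ∞ M]

/-- A field of `p`-forms is smooth if its contraction with smooth local vector fields is smooth. -/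
def FormField.IsSmooth (Ψ : FormField I M p) : Prop :=
  ∀ (U : Set M), IsOpen U → ∀ Y : Fin p → Π x : M, TangentSpace I x,
    (∀ i, CMDiff[U] ∞ (T% (Y i))) → CMDiff[U] ∞ (fun x => Ψ x (fun i => Y i x))

/-- `(∇_v Ψ)(Y₁, …, Y_p) = v(Ψ(Y₁, …, Y_p)) - ∑ᵢ Ψ(Y₁, …, ∇_v Yᵢ, …, Y_p)` at `x`,
for vector fields `Y₁, …, Y_p`. -/
def covDerivFields (cov : CovariantDerivative I E (TangentSpace I : M → Type _))
    (Ψ : Cochain I M p) {x : M} (v : TangentSpace I x)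
    (Y : Fin p → Π x : M, TangentSpace I x) : ℝ :=
  mvfderiv I (fun y => Ψ y (fun i => Y i y)) x v
    - ∑ i, Ψ x (Function.update (fun j => Y j x) i (cov (Y i) x v))

/-- The covariant derivative `(∇_v Ψ)(w₁, …, w_p)` of a form at the point `x`. The vectors are
extended to vector fields; for a smooth form the result does not depend on the extension. -/
def covDeriv (cov : CovariantDerivative I E (TangentSpace I : M → Type _))
    (Ψ : Cochain I M p) (x : M) (v : TangentSpace I x) (w : Fin p → TangentSpace I x) : ℝ :=
  covDerivFields cov Ψ v (fun i => FiberBundle.extend E (w i))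

/-- `∑ₐ e^a ∧ ∇_{e_a} Ψ`. -/
def covExtDeriv (cov : CovariantDerivative I E (TangentSpace I : M → Type _))
    (Ψ : Cochain I M p) : Cochain I M (p + 1) :=
  fun x w => ∑ i : Fin (p + 1), (-1 : ℝ) ^ (i : ℕ) * covDeriv cov Ψ x (w i) (i.removeNth w)

variable [RiemannianBundle (fun x : M => TangentSpace I x)]

/-- `-∑ₐ e_a ⌟ ∇_{e_a} Ψ`, the sum being over an orthonormal basis. -/
def covCodiff (cov : CovariantDerivative I E (TangentSpace I : M → Type _))
    (Ψ : Cochain I M (p + 1)) : Cochain I M p :=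
  fun x w => -∑ a, covDeriv cov Ψ x (stdOrthonormalBasis ℝ (TangentSpace I x) a)
    (Matrix.vecCons (stdOrthonormalBasis ℝ (TangentSpace I x) a) w)

/-- The wedge product `v♭ ∧ β` at `x`. -/
def flatWedge (β : Cochain I M p) (x : M) (v : TangentSpace I x)
    (w : Fin (p + 1) → TangentSpace I x) : ℝ :=
  ∑ i : Fin (p + 1), (-1 : ℝ) ^ (i : ℕ) * (inner ℝ v (w i) * β x (i.removeNth w))

/-- The bilinear map `(Y, X) ↦ (1/2) ∑ₐ T(X, Y, e_a) e_a` at `x`. -/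
def torsionTerm (T : FormField I M 3) (x : M) :
    TangentSpace I x →L[ℝ] TangentSpace I x →L[ℝ] TangentSpace I x :=
  LinearMap.toContinuousLinearMap
    ((LinearMap.toContinuousLinearMap (𝕜 := ℝ) (E := TangentSpace I x)
        (F' := TangentSpace I x)).toLinearMap ∘ₗ
      LinearMap.mk₂ ℝ (fun Y X => (1 / 2 : ℝ) •
        ∑ a, T x ![X, Y, stdOrthonormalBasis ℝ (TangentSpace I x) a] •
          stdOrthonormalBasis ℝ (TangentSpace I x) a)
        (fun Y Y' X => by
          simp only [FormField.swap₀₁ T X, FormField.add₀, neg_add, add_smul,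
            Finset.sum_add_distrib, smul_add])
        (fun c Y X => by
          simp only [FormField.swap₀₁ T X, FormField.smul₀, ← mul_neg, mul_smul,
            ← Finset.smul_sum]
          exact smul_comm _ _ _)
        (fun Y X X' => by
          simp only [FormField.add₀, add_smul, Finset.sum_add_distrib, smul_add])
        (fun c Y X => by
          simp only [FormField.smul₀, mul_smul, ← Finset.smul_sum]
          exact smul_comm _ _ _))

variable [IsContMDiffRiemannianBundle I ∞ E (fun x : M => TangentSpace I x)]

/-- The connection with torsion `∇^T_X Y = ∇_X Y + (1/2) ∑ₐ T(X, Y, e_a) e_a`. -/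
def nablaT (T : FormField I M 3) : CovariantDerivative I E (TangentSpace I : M → Type _) :=
  leviCivita.addOneForm (torsionTerm T)

theorem nablaT_apply (T : FormField I M 3) (Y : Π x : M, TangentSpace I x) (x : M)
    (v : TangentSpace I x) :
    nablaT T Y x v = leviCivita Y x v + (1 / 2 : ℝ) •
      ∑ a, T x ![v, Y x, stdOrthonormalBasis ℝ (TangentSpace I x) a] •
        stdOrthonormalBasis ℝ (TangentSpace I x) a :=
  rfl

/-- A generalized conformal Killing-Yano tensor of rank `q = p + 1`:
`∇^T_X k = 1/(q+1) X ⌟ d^T k - 1/(D-q+1) X♭ ∧ δ^T k`. -/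
def IsGCKY (T : FormField I M 3) (k : FormField I M (p + 1)) : Prop :=
  ∀ (x : M) (v : TangentSpace I x) (w : Fin (p + 1) → TangentSpace I x),
    covDeriv (nablaT T) k.toCochain x v w =
      1 / ((p : ℝ) + 2) * covExtDeriv (nablaT T) k.toCochain x (Matrix.vecCons v w)
        - 1 / ((Module.finrank ℝ E : ℝ) - p) *
          flatWedge (covCodiff (nablaT T) k.toCochain) x v w

/-- The associated 1-form `ξ = -1/(D-1) δ^T h`. -/
def associatedForm (T : FormField I M 3) (h : FormField I M 2) : Cochain I M 1 :=
  fun x w => -(1 / ((Module.finrank ℝ E : ℝ) - 1)) * covCodiff (nablaT T) h.toCochain x w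

end Forms

/-! ### Principal Killing-Yano tensors and canonical frames in dimension `2n + 1` -/

section Odd

/-- The index set `{μ} ∪ {μ̂} ∪ {0}`, `μ = 1, …, n`, of a Darboux frame. -/
abbrev FrameIdx (n : ℕ) : Type := Fin n ⊕ Fin n ⊕ Unit

/-- The index `μ`. -/
abbrev FrameIdx.base {n : ℕ} (μ : Fin n) : FrameIdx n := Sum.inl μ

/-- The index `μ̂`. -/
abbrev FrameIdx.hat {n : ℕ} (μ : Fin n) : FrameIdx n := Sum.inr (Sum.inl μ)

/-- The index `0`. -/
abbrev FrameIdx.zero {n : ℕ} : FrameIdx n := Sum.inr (Sum.inr ())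

variable {E : Type*} [NormedAddCommGroup E] [NormedSpace ℝ E] [FiniteDimensional ℝ E]
  {H : Type*} [TopologicalSpace H] {I : ModelWithCorners ℝ E H}
  {M : Type*} [TopologicalSpace M] [ChartedSpace H M] [IsManifold I ∞ M]
  [RiemannianBundle (fun x : M => TangentSpace I x)]
  {n : ℕ}

/-- The 2-form `h` at the point `p` is `∑_μ x_μ e^μ ∧ e^μ̂` with respect to vectors `e_a`, where
`e^a = g(e_a, ·)`. -/
def IsDarbouxAt (h : FormField I M 2) (p : M) (x : Fin n → ℝ)
    (e : FrameIdx n → TangentSpace I p) : Prop :=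
  ∀ v w : TangentSpace I p, h p ![v, w] =
    ∑ μ, x μ * (inner ℝ (e (.base μ)) v * inner ℝ (e (.hat μ)) w
      - inner ℝ (e (.hat μ)) v * inner ℝ (e (.base μ)) w)

/-- The numbers `x_μ` list the eigenvalues of `h` at the point `p`, i.e. the endomorphism `h♯` has
the eigenvalues `± i x_μ` and `0`, with multiplicity: for the skew-symmetric `h♯` this means that
`h` is `∑_μ x_μ e^μ ∧ e^μ̂` in some orthonormal basis of the tangent space. -/
def IsEigenvaluesAt (h : FormField I M 2) (p : M) (x : Fin n → ℝ) : Prop :=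
  ∃ e : FrameIdx n → TangentSpace I p, Orthonormal ℝ e ∧ IsDarbouxAt h p x e

/-- `x_1, …, x_n` are smooth functions on `U` that list the eigenvalues of `h`. -/
structure IsEigenvaluesOn (h : FormField I M 2) (U : Set M) (x : Fin n → M → ℝ) : Prop where
  smooth : ∀ μ, CMDiff[U] ∞ (x μ)
  eigenvalues : ∀ p ∈ U, IsEigenvaluesAt h p (fun μ => x μ p)

/-- The endomorphism `h♯` as the map `v ↦ h(v, ·)` into the functions on the tangent space. -/
def contraction (h : FormField I M 2) (p : M) :
    TangentSpace I p →ₗ[ℝ] (TangentSpace I p → ℝ) where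
  toFun v w := h p ![v, w]
  map_add' u v := by
    funext w
    have e (z : TangentSpace I p) : Function.update ![u, w] 0 z = ![z, w] := by
      funext i
      fin_cases i <;> rfl
    have h' := (h p).map_update_add ![u, w] 0 u v
    rw [e, e, e] at h'
    exact h'
  map_smul' c v := by
    funext w
    have e (z : TangentSpace I p) : Function.update ![v, w] 0 z = ![z, w] := by
      funext i
      fin_cases i <;> rfl
    have h' := (h p).map_update_smul ![v, w] 0 c v
    rw [e, e] at h'
    exact h'

variable (n) in
/-- `h` is non-degenerate: its rank is maximal (equal to `2n`) at all points, and its eigenvalues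
are (locally smooth and) functionally independent. -/
structure IsNondegenerate (h : FormField I M 2) : Prop where
  rank_eq : ∀ p : M, Module.finrank ℝ (LinearMap.range (contraction h p)) = 2 * n
  exists_eigenvalues : ∀ p : M, ∃ U : Set M, IsOpen U ∧ p ∈ U ∧
    ∃ x : Fin n → M → ℝ, IsEigenvaluesOn h U x
  independent : ∀ (U : Set M), IsOpen U → ∀ x : Fin n → M → ℝ, IsEigenvaluesOn h U x →
    ∀ p ∈ U, LinearIndependent ℝ (fun μ => mvfderiv I (x μ) p)

variable [IsContMDiffRiemannianBundle I ∞ E (fun x : M => TangentSpace I x)]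

variable (n) in
/-- A principal Killing-Yano tensor with torsion: a smooth non-degenerate `d^T`-closed generalized
conformal Killing-Yano 2-form. -/
structure IsPrincipalKillingYano (T : FormField I M 3) (h : FormField I M 2) : Prop where
  smooth : h.IsSmooth
  gcky : IsGCKY T h
  closed : ∀ (x : M) (w : Fin 3 → TangentSpace I x),
    covExtDeriv (nablaT T) h.toCochain x w = 0
  nondegenerate : IsNondegenerate n h

/-- A canonical frame of `h` on `U`: a smooth orthonormal frame `e_μ, e_μ̂, e_0` such that
`h = ∑_μ x_μ e^μ ∧ e^μ̂` and `ξ = ∑_μ √Q_μ e^μ̂ + √Q_0 e^0` on `U`. -/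
structure IsCanonicalFrame (T : FormField I M 3) (h : FormField I M 2) (U : Set M)
    (e : FrameIdx n → Π p : M, TangentSpace I p) (x : Fin n → M → ℝ)
    (Q : Fin n → M → ℝ) (Q₀ : M → ℝ) : Prop where
  smooth : ∀ a, CMDiff[U] ∞ (T% (e a))
  orthonormal : ∀ p ∈ U, Orthonormal ℝ (fun a => e a p)
  darboux : ∀ p ∈ U, IsDarbouxAt h p (fun μ => x μ p) (fun a => e a p)
  Q_nonneg : ∀ p ∈ U, ∀ μ, 0 ≤ Q μ p
  Q₀_nonneg : ∀ p ∈ U, 0 ≤ Q₀ p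
  xi_eq : ∀ p ∈ U, ∀ v : TangentSpace I p, associatedForm T h p (fun _ => v) =
    ∑ μ, √(Q μ p) * inner ℝ (e (.hat μ) p) v + √(Q₀ p) * inner ℝ (e .zero p) v

/-- The dual coframe `e^a` at `p` of an orthonormal frame. -/
def coframe (e : FrameIdx n → Π p : M, TangentSpace I p) (a : FrameIdx n) (p : M) :
    TangentSpace I p →L[ℝ] ℝ :=
  innerSL ℝ (e a p)

/-- The connection 1-form `ω^c_b` at `p` of a connection with respect to an orthonormal frame:
`∇_v e_b = ∑_c ω^c_b(v) e_c`. -/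
def connForm (cov : CovariantDerivative I E (TangentSpace I : M → Type _))
    (e : FrameIdx n → Π p : M, TangentSpace I p) (c b : FrameIdx n) (p : M) :
    TangentSpace I p →L[ℝ] ℝ :=
  (coframe e c p).comp (cov (e b) p)

/-- `κ_a^b = (e^b)_c ∇^T_a ξ^c`, i.e. `(∇^T_{e_a} ξ)(e_b)` for the associated 1-form `ξ` and an
orthonormal frame. -/
def kappa (T : FormField I M 3) (h : FormField I M 2)
    (e : FrameIdx n → Π p : M, TangentSpace I p) (a b : FrameIdx n) (p : M) : ℝ :=
  covDerivFields (nablaT T) (associatedForm T h) (e a p) (fun _ => e b)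

end Odd

end TorsionKY

end

open TorsionKY

namespace TorsionKY

section Calculus

variable {E : Type*} [NormedAddCommGroup E] [NormedSpace ℝ E]
  {H : Type*} [TopologicalSpace H] {I : ModelWithCorners ℝ E H}
  {M : Type*} [TopologicalSpace M] [ChartedSpace H M]

theorem mvfderiv_congr_of_eventuallyEq {f g : M → ℝ} {p : M} (hfg : f =ᶠ[nhds p] g) :
    mvfderiv I f p = mvfderiv I g p := by
  ext v
  simp only [mvfderiv, ContinuousLinearMap.comp_apply]
  rw [hfg.mfderiv_eq]
  rfl

theorem mdiffAt_sum_and_mvfderiv_sum {ι : Type*} (s : Finset ι) {f : ι → M → ℝ} {p : M}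
    (hf : ∀ i, MDiffAt (f i) p) :
    MDiffAt (fun y => ∑ i ∈ s, f i y) p ∧
      mvfderiv I (fun y => ∑ i ∈ s, f i y) p = ∑ i ∈ s, mvfderiv I (f i) p := by
  classical
  induction s using Finset.induction_on with
  | empty => exact ⟨by simpa using mdifferentiableAt_const, by simp [mvfderiv_const]⟩
  | insert a s ha ih =>
    simp only [Finset.sum_insert ha]
    refine ⟨(hf a).add ih.1, ?_⟩
    rw [mvfderiv_fun_add (hf a) ih.1, ih.2]

end Calculus

section Metric

set_option linter.unusedSectionVars false

variable {E : Type*} [NormedAddCommGroup E] [NormedSpace ℝ E] [FiniteDimensional ℝ E]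
  {H : Type*} [TopologicalSpace H] {I : ModelWithCorners ℝ E H}
  {M : Type*} [TopologicalSpace M] [ChartedSpace H M] [IsManifold I ∞ M]
  [RiemannianBundle (fun x : M => TangentSpace I x)]

theorem FormField.swap₁₂ (T : FormField I M 3) {x : M} (u v w : TangentSpace I x) :
    T x ![u, v, w] = -T x ![u, w, v] := by
  have e : ![u, v, w] = ![u, w, v] ∘ Equiv.swap 1 2 := by
    funext i
    fin_cases i <;> rfl
  rw [e]
  exact (T x).toAlternatingMap.map_swap ![u, w, v] (by decide)

theorem FormField.add₂ (T : FormField I M 3) {x : M} (u v w w' : TangentSpace I x) :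
    T x ![u, v, w + w'] = T x ![u, v, w] + T x ![u, v, w'] := by
  have e (z : TangentSpace I x) : Function.update ![u, v, w] 2 z = ![u, v, z] := by
    funext i
    fin_cases i <;> rfl
  have h := (T x).map_update_add ![u, v, w] 2 w w'
  rw [e, e, e] at h
  exact h

theorem FormField.smul₂ (T : FormField I M 3) {x : M} (c : ℝ) (u v w : TangentSpace I x) :
    T x ![u, v, c • w] = c * T x ![u, v, w] := by
  have e (z : TangentSpace I x) : Function.update ![u, v, w] 2 z = ![u, v, z] := by
    funext i
    fin_cases i <;> rfl
  have h := (T x).map_update_smul ![u, v, w] 2 c w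
  rw [e, e] at h
  exact h

/-- The linear functional `w ↦ T(u, v, w)`. -/
noncomputable def FormField.last (T : FormField I M 3) (x : M) (u v : TangentSpace I x) :
    TangentSpace I x →ₗ[ℝ] ℝ where
  toFun w := T x ![u, v, w]
  map_add' := T.add₂ u v
  map_smul' c := T.smul₂ c u v

theorem inner_torsion_sum (T : FormField I M 3) (x : M) (u v w : TangentSpace I x) :
    inner ℝ (∑ a, T x ![u, v, stdOrthonormalBasis ℝ (TangentSpace I x) a] •
      stdOrthonormalBasis ℝ (TangentSpace I x) a) w = T x ![u, v, w] := by
  have h := congrArg (T.last x u v) ((stdOrthonormalBasis ℝ (TangentSpace I x)).sum_repr' w)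
  rw [map_sum] at h
  rw [sum_inner]
  change _ = T.last x u v w
  rw [← h]
  refine Finset.sum_congr rfl fun a _ => ?_
  rw [map_smul, real_inner_smul_left, smul_eq_mul, mul_comm]
  rfl

variable [IsContMDiffRiemannianBundle I ∞ E (fun x : M => TangentSpace I x)]

theorem nablaT_metric (T : FormField I M 3) {Y Z : Π x : M, TangentSpace I x} {x : M}
    (hY : MDiffAt (T% Y) x) (hZ : MDiffAt (T% Z) x) (v : TangentSpace I x) :
    mvfderiv I (fun y => inner ℝ (Y y) (Z y)) x v =
      inner ℝ (nablaT T Y x v) (Z x) + inner ℝ (Y x) (nablaT T Z x v) := by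
  have hv : MDiffAt (T% (FiberBundle.extend E v)) x := FiberBundle.mdifferentiableAt_extend ..
  have h := leviCivita_metric hv hY hZ
  rw [FiberBundle.extend_apply_self] at h
  rw [h, nablaT_apply, nablaT_apply, inner_add_left, inner_add_right, real_inner_smul_left,
    real_inner_smul_right, inner_torsion_sum, real_inner_comm _ (Y x), real_inner_comm _ (Y x),
    inner_torsion_sum,
    T.swap₁₂ v (Z x) (Y x)]
  ring

variable {n : ℕ}

/-- The covariant derivative of a 2-form `∑_μ x_μ e^μ ∧ e^μ̂`. -/
theorem covDeriv_darboux (T : FormField I M 3) (h : FormField I M 2) {U : Set M} (hU : IsOpen U)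
    {e : FrameIdx n → Π p : M, TangentSpace I p} {x : Fin n → M → ℝ}
    (hd : ∀ p ∈ U, IsDarbouxAt h p (fun μ => x μ p) (fun a => e a p)) {p : M} (hp : p ∈ U)
    (he : ∀ a, MDiffAt (T% (e a)) p) (hx : ∀ μ, MDiffAt (x μ) p) (v w w' : TangentSpace I p) :
    covDeriv (nablaT T) h.toCochain p v ![w, w'] =
      ∑ μ, (mvfderiv I (x μ) p v * (inner ℝ (e (.base μ) p) w * inner ℝ (e (.hat μ) p) w'
          - inner ℝ (e (.hat μ) p) w * inner ℝ (e (.base μ) p) w')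
        + x μ p * (inner ℝ (nablaT T (e (.base μ)) p v) w * inner ℝ (e (.hat μ) p) w'
          + inner ℝ (e (.base μ) p) w * inner ℝ (nablaT T (e (.hat μ)) p v) w'
          - inner ℝ (nablaT T (e (.hat μ)) p v) w * inner ℝ (e (.base μ) p) w'
          - inner ℝ (e (.hat μ) p) w * inner ℝ (nablaT T (e (.base μ)) p v) w')) := by
  set W := FiberBundle.extend E w with hW
  set W' := FiberBundle.extend E w' with hW'
  have hWd : MDiffAt (T% W) p := FiberBundle.mdifferentiableAt_extend ..
  have hWd' : MDiffAt (T% W') p := FiberBundle.mdifferentiableAt_extend ..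
  have hWp : W p = w := FiberBundle.extend_apply_self ..
  have hWp' : W' p = w' := FiberBundle.extend_apply_self ..
  have hev : (fun y => h.toCochain y (fun i => FiberBundle.extend E (![w, w'] i) y)) =ᶠ[nhds p]
      fun y => ∑ μ, x μ y * (inner ℝ (e (.base μ) y) (W y) * inner ℝ (e (.hat μ) y) (W' y)
        - inner ℝ (e (.hat μ) y) (W y) * inner ℝ (e (.base μ) y) (W' y)) := by
    filter_upwards [hU.mem_nhds hp] with y hy
    rw [← hd y hy]
    change h y _ = h y _
    congr 1
    funext i
    fin_cases i <;> rfl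
  have hi (a) : MDiffAt (fun y => inner ℝ (e a y) (W y)) p := mdiffAt_inner (he a) hWd
  have hi' (a) : MDiffAt (fun y => inner ℝ (e a y) (W' y)) p := mdiffAt_inner (he a) hWd'
  have hu0 (z : TangentSpace I p) : h.toCochain p (Function.update
      (fun j => FiberBundle.extend E (![w, w'] j) p) 0 z) = h p ![z, w'] := by
    change h p _ = h p _
    congr 1
    funext i
    fin_cases i
    · rfl
    · exact hWp'
  have hu1 (z : TangentSpace I p) : h.toCochain p (Function.update
      (fun j => FiberBundle.extend E (![w, w'] j) p) 1 z) = h p ![w, z] := by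
    change h p _ = h p _
    congr 1
    funext i
    fin_cases i
    · exact hWp
    · rfl
  have hm (μ) : MDiffAt (fun y => inner ℝ (e (.base μ) y) (W y) * inner ℝ (e (.hat μ) y) (W' y)) p :=
    (hi (.base μ)).mul (hi' (.hat μ))
  have hm' (μ) : MDiffAt (fun y => inner ℝ (e (.hat μ) y) (W y) * inner ℝ (e (.base μ) y) (W' y)) p :=
    (hi (.hat μ)).mul (hi' (.base μ))
  have hs (μ) : MDiffAt (fun y => inner ℝ (e (.base μ) y) (W y) * inner ℝ (e (.hat μ) y) (W' y)
      - inner ℝ (e (.hat μ) y) (W y) * inner ℝ (e (.base μ) y) (W' y)) p :=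
    (hm μ).sub (hm' μ)
  have ht (μ) : MDiffAt (fun y => x μ y * (inner ℝ (e (.base μ) y) (W y) *
      inner ℝ (e (.hat μ) y) (W' y) - inner ℝ (e (.hat μ) y) (W y) *
      inner ℝ (e (.base μ) y) (W' y))) p := (hx μ).mul (hs μ)
  rw [covDeriv, covDerivFields, mvfderiv_congr_of_eventuallyEq hev,
    (mdiffAt_sum_and_mvfderiv_sum Finset.univ ht).2, Fin.sum_univ_two,
    hu0, hu1, hd p hp, hd p hp, ← Finset.sum_add_distrib, FunLike.coe_sum, Finset.sum_apply,
    ← Finset.sum_sub_distrib]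
  refine Finset.sum_congr rfl fun μ _ => ?_
  rw [mvfderiv_fun_mul (hx μ) (hs μ), mvfderiv_fun_sub (hm μ) (hm' μ),
    mvfderiv_fun_mul (hi (.base μ)) (hi' (.hat μ)), mvfderiv_fun_mul (hi (.hat μ)) (hi' (.base μ))]
  simp only [add_apply, sub_apply, smul_apply, smul_eq_mul, nablaT_metric T (he _) hWd,
    nablaT_metric T (he _) hWd', hWp, hWp', Matrix.cons_val_zero, Matrix.cons_val_one, ← hW, ← hW']
  ring

theorem flatWedge_smul (c : ℝ) (β : Cochain I M 1) (x : M) (v w w' : TangentSpace I x) :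
    c * flatWedge β x v ![w, w'] =
      inner ℝ v w * (c * β x fun _ => w') - inner ℝ v w' * (c * β x fun _ => w) := by
  have h0 : Fin.removeNth (0 : Fin 2) ![w, w'] = fun _ : Fin 1 => w' := by
    funext i
    fin_cases i
    rfl
  have h1 : Fin.removeNth (1 : Fin 2) ![w, w'] = fun _ : Fin 1 => w := by
    funext i
    fin_cases i
    rfl
  rw [flatWedge, Fin.sum_univ_two, h0, h1]
  simp
  ring

/-- For a `d^T`-closed generalized conformal Killing-Yano 2-form, `∇^T_v h = v♭ ∧ ξ`. -/
theorem covDeriv_of_closed {T : FormField I M 3} {h : FormField I M 2} (hk : IsGCKY T h)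
    (hc : ∀ (x : M) (w : Fin 3 → TangentSpace I x), covExtDeriv (nablaT T) h.toCochain x w = 0)
    (p : M) (v w w' : TangentSpace I p) :
    covDeriv (nablaT T) h.toCochain p v ![w, w'] =
      inner ℝ v w * associatedForm T h p (fun _ => w') -
        inner ℝ v w' * associatedForm T h p (fun _ => w) := by
  rw [hk, hc, mul_zero, zero_sub, Nat.cast_one, ← neg_mul, flatWedge_smul]
  rfl

theorem coeff_ne_zero {h : FormField I M 2} {p : M} {x : Fin n → ℝ}
    {e : FrameIdx n → TangentSpace I p} (he : Orthonormal ℝ e) (hd : IsDarbouxAt h p x e)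
    (hE : Module.finrank ℝ E = 2 * n + 1)
    (hr : Module.finrank ℝ (LinearMap.range (contraction h p)) = 2 * n) (μ : Fin n) :
    x μ ≠ 0 := by
  intro hx
  have hk : Module.finrank ℝ (LinearMap.ker (contraction h p)) = 1 := by
    have h1 := LinearMap.finrank_range_add_finrank_ker (contraction h p)
    have h2 : Module.finrank ℝ (TangentSpace I p) = 2 * n + 1 := hE
    omega
  have hin := orthonormal_iff_ite.1 he
  have h1 : e (.base μ) ∈ LinearMap.ker (contraction h p) := by
    rw [LinearMap.mem_ker]
    funext w
    change h p ![e (.base μ), w] = 0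
    rw [hd]
    simp [hin, hx]
  have h0 : e .zero ∈ LinearMap.ker (contraction h p) := by
    rw [LinearMap.mem_ker]
    funext w
    change h p ![e .zero, w] = 0
    rw [hd]
    simp [hin]
  obtain ⟨c, hc⟩ := (finrank_eq_one_iff_of_nonzero' (⟨e .zero, h0⟩ :
    LinearMap.ker (contraction h p)) (fun hz => he.ne_zero _ (congrArg Subtype.val hz))).1 hk
    ⟨_, h1⟩
  have hc' : c • e .zero = e (.base μ) := congrArg Subtype.val hc
  have := hin (.base μ) (.base μ)
  rw [← hc', real_inner_smul_left, hc', hin] at this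
  simp at this

theorem connForm_antisymm (T : FormField I M 3) {U : Set M} (hU : IsOpen U)
    {e : FrameIdx n → Π p : M, TangentSpace I p} {p : M} (hp : p ∈ U)
    (ho : ∀ p ∈ U, Orthonormal ℝ (fun a => e a p)) (he : ∀ a, MDiffAt (T% (e a)) p)
    (a b : FrameIdx n) (v : TangentSpace I p) :
    connForm (nablaT T) e a b p v = -connForm (nablaT T) e b a p v := by
  have hev : (fun y => inner ℝ (e a y) (e b y)) =ᶠ[nhds p] fun _ => if a = b then (1 : ℝ) else 0 := by
    filter_upwards [hU.mem_nhds hp] with y hy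
    exact orthonormal_iff_ite.1 (ho y hy) a b
  have h := nablaT_metric T (he a) (he b) v
  rw [mvfderiv_congr_of_eventuallyEq hev, mvfderiv_const, real_inner_comm] at h
  change inner ℝ (e a p) (nablaT T (e b) p v) = -inner ℝ (e b p) (nablaT T (e a) p v)
  rw [zero_apply] at h
  linarith

end Metric

end TorsionKY

namespace TorsionKY

section CanonicalFrame

set_option linter.unusedSectionVars false

variable {E : Type*} [NormedAddCommGroup E] [NormedSpace ℝ E] [FiniteDimensional ℝ E]
  {H : Type*} [TopologicalSpace H] {I : ModelWithCorners ℝ E H}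
  {M : Type*} [TopologicalSpace M] [ChartedSpace H M] [IsManifold I ∞ M]
  [RiemannianBundle (fun x : M => TangentSpace I x)]
  [IsContMDiffRiemannianBundle I ∞ E (fun x : M => TangentSpace I x)]
  {n : ℕ} {T : FormField I M 3} {h : FormField I M 2} {U : Set M}
  {e : FrameIdx n → Π p : M, TangentSpace I p} {x Q : Fin n → M → ℝ} {Q₀ : M → ℝ}

theorem IsCanonicalFrame.mdiffAt (hf : IsCanonicalFrame T h U e x Q Q₀) (hU : IsOpen U) {p : M}
    (hp : p ∈ U) (a : FrameIdx n) : MDiffAt (T% (e a)) p :=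
  ((hf.smooth a).contMDiffAt (hU.mem_nhds hp)).mdifferentiableAt (by simp)

theorem IsCanonicalFrame.inner_eq (hf : IsCanonicalFrame T h U e x Q Q₀) {p : M} (hp : p ∈ U)
    (a b : FrameIdx n) : inner ℝ (e a p) (e b p) = if a = b then (1 : ℝ) else 0 :=
  orthonormal_iff_ite.1 (hf.orthonormal p hp) a b

theorem IsCanonicalFrame.isEigenvaluesOn (hf : IsCanonicalFrame T h U e x Q Q₀) (hU : IsOpen U)
    (hs : h.IsSmooth) : IsEigenvaluesOn h U x where
  smooth μ := by
    refine (hs U hU ![e (.base μ), e (.hat μ)] fun i => ?_).congr fun p hp => ?_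
    · fin_cases i
      · exact hf.smooth _
      · exact hf.smooth _
    · have hv : (fun i => (![e (.base μ), e (.hat μ)] : Fin 2 → Π p : M, TangentSpace I p) i p) =
          ![e (.base μ) p, e (.hat μ) p] := by
        funext i
        fin_cases i <;> rfl
      rw [hv, hf.darboux p hp]
      simp [hf.inner_eq hp]
  eigenvalues p hp := ⟨_, hf.orthonormal p hp, hf.darboux p hp⟩

/-- The component `∇^T_v h (e_a, e_b) = (v♭ ∧ ξ) (e_a, e_b)` in a canonical frame. -/
theorem IsCanonicalFrame.structure_eq (hf : IsCanonicalFrame T h U e x Q Q₀) (hU : IsOpen U)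
    (hh : IsPrincipalKillingYano n T h) {p : M} (hp : p ∈ U) (v : TangentSpace I p)
    (a b : FrameIdx n) :
    ∑ μ, (mvfderiv I (x μ) p v * ((if .base μ = a then 1 else 0) * (if .hat μ = b then 1 else 0)
          - (if .hat μ = a then 1 else 0) * (if .base μ = b then 1 else 0))
        + x μ p * (connForm (nablaT T) e a (.base μ) p v * (if .hat μ = b then 1 else 0)
          + (if .base μ = a then 1 else 0) * connForm (nablaT T) e b (.hat μ) p v
          - connForm (nablaT T) e a (.hat μ) p v * (if .base μ = b then 1 else 0)
          - (if .hat μ = a then 1 else 0) * connForm (nablaT T) e b (.base μ) p v)) =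
      coframe e a p v * associatedForm T h p (fun _ => e b p) -
        coframe e b p v * associatedForm T h p (fun _ => e a p) := by
  have hx (μ) : MDiffAt (x μ) p := (((hf.isEigenvaluesOn hU hh.smooth).smooth μ).contMDiffAt
    (hU.mem_nhds hp)).mdifferentiableAt (by simp)
  have h1 := covDeriv_of_closed hh.gcky hh.closed p v (e a p) (e b p)
  rw [covDeriv_darboux T h hU hf.darboux hp (hf.mdiffAt hU hp) hx, real_inner_comm (e a p),
    real_inner_comm (e b p)] at h1
  simp only [hf.inner_eq hp, real_inner_comm (e a p) (nablaT T _ _ _),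
    real_inner_comm (e b p) (nablaT T _ _ _)] at h1
  exact h1

theorem IsCanonicalFrame.xi_base (hf : IsCanonicalFrame T h U e x Q Q₀) {p : M} (hp : p ∈ U)
    (μ : Fin n) : associatedForm T h p (fun _ => e (.base μ) p) = 0 := by
  simp [hf.xi_eq p hp, hf.inner_eq hp]

theorem IsCanonicalFrame.xi_hat (hf : IsCanonicalFrame T h U e x Q Q₀) {p : M} (hp : p ∈ U)
    (μ : Fin n) : associatedForm T h p (fun _ => e (.hat μ) p) = √(Q μ p) := by
  simp [hf.xi_eq p hp, hf.inner_eq hp]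

theorem IsCanonicalFrame.xi_zero (hf : IsCanonicalFrame T h U e x Q Q₀) {p : M} (hp : p ∈ U) :
    associatedForm T h p (fun _ => e .zero p) = √(Q₀ p) := by
  simp [hf.xi_eq p hp, hf.inner_eq hp, (hf.orthonormal p hp).1 .zero]

/-- `κ_a^μ = -∑_c ξ_c ω^c_μ(e_a)`. -/
theorem IsCanonicalFrame.kappa_base (hf : IsCanonicalFrame T h U e x Q Q₀) (hU : IsOpen U) {p : M}
    (hp : p ∈ U) (a : FrameIdx n) (μ : Fin n) :
    kappa T h e a (.base μ) p =
      -(∑ ν, √(Q ν p) * connForm (nablaT T) e (.hat ν) (.base μ) p (e a p)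
        + √(Q₀ p) * connForm (nablaT T) e .zero (.base μ) p (e a p)) := by
  have hev : (fun y => associatedForm T h y fun _ => e (.base μ) y) =ᶠ[nhds p] fun _ => 0 := by
    filter_upwards [hU.mem_nhds hp] with y hy using hf.xi_base hy μ
  have hup (z : TangentSpace I p) :
      Function.update (fun _ : Fin 1 => e (.base μ) p) 0 z = fun _ => z := by
    funext i
    fin_cases i
    rfl
  rw [kappa, covDerivFields, mvfderiv_congr_of_eventuallyEq hev, mvfderiv_const,
    Fin.sum_univ_one, hup, hf.xi_eq p hp, zero_apply, zero_sub]
  rfl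

theorem IsCanonicalFrame.mvfderiv_eq (hf : IsCanonicalFrame T h U e x Q Q₀) (hU : IsOpen U)
    (hh : IsPrincipalKillingYano n T h) {p : M} (hp : p ∈ U)
    (v : TangentSpace I p) (μ : Fin n) :
    mvfderiv I (x μ) p v = coframe e (.base μ) p v * √(Q μ p) := by
  have h1 := hf.structure_eq hU hh hp v (.base μ) (.hat μ)
  have ha (a) := connForm_antisymm T hU hp hf.orthonormal (hf.mdiffAt hU hp) a a v
  have ha' (a) : connForm (nablaT T) e a a p v = 0 := by linarith [ha a]
  simpa [hf.xi_base hp, hf.xi_hat hp, ha', Finset.sum_add_distrib, mul_add] using h1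

theorem IsCanonicalFrame.Q_ne_zero (hf : IsCanonicalFrame T h U e x Q Q₀) (hU : IsOpen U)
    (hh : IsPrincipalKillingYano n T h) {p : M} (hp : p ∈ U)
    (μ : Fin n) : Q μ p ≠ 0 := by
  intro hQ
  refine (hh.nondegenerate.independent U hU x (hf.isEigenvaluesOn hU hh.smooth) p hp).ne_zero μ ?_
  ext v
  rw [hf.mvfderiv_eq hU hh hp, hQ, Real.sqrt_zero, mul_zero]
  rfl

theorem IsCanonicalFrame.base_base (hf : IsCanonicalFrame T h U e x Q Q₀) (hU : IsOpen U)
    (hh : IsPrincipalKillingYano n T h) {p : M} (hp : p ∈ U)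
    (v : TangentSpace I p) (μ ν : Fin n) (hμν : μ ≠ ν) :
    (x μ p ^ 2 - x ν p ^ 2) * connForm (nablaT T) e (.base μ) (.base ν) p v =
      -(x ν p * √(Q ν p)) * coframe e (.base μ) p v
        - x μ p * √(Q μ p) * coframe e (.base ν) p v := by
  have h1 := hf.structure_eq hU hh hp v (.base μ) (.hat ν)
  have h2 := hf.structure_eq hU hh hp v (.base ν) (.hat μ)
  have ha := connForm_antisymm T hU hp hf.orthonormal (hf.mdiffAt hU hp)
  simp [hf.xi_base hp, hf.xi_hat hp, hμν, hμν.symm, Finset.sum_add_distrib, mul_add] at h1 h2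
  rw [ha (.base ν) (.base μ), ha (.hat μ) (.hat ν)] at h2
  linear_combination -x ν p * h1 - x μ p * h2

theorem IsCanonicalFrame.hat_hat (hf : IsCanonicalFrame T h U e x Q Q₀) (hU : IsOpen U)
    (hh : IsPrincipalKillingYano n T h) {p : M} (hp : p ∈ U)
    (v : TangentSpace I p) (μ ν : Fin n) (hμν : μ ≠ ν) :
    (x μ p ^ 2 - x ν p ^ 2) * connForm (nablaT T) e (.hat μ) (.hat ν) p v =
      -(x μ p * √(Q ν p)) * coframe e (.base μ) p v
        - x ν p * √(Q μ p) * coframe e (.base ν) p v := by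
  have h1 := hf.structure_eq hU hh hp v (.base μ) (.hat ν)
  have h2 := hf.structure_eq hU hh hp v (.base ν) (.hat μ)
  have ha := connForm_antisymm T hU hp hf.orthonormal (hf.mdiffAt hU hp)
  simp [hf.xi_base hp, hf.xi_hat hp, hμν, hμν.symm, Finset.sum_add_distrib, mul_add] at h1 h2
  rw [ha (.base ν) (.base μ), ha (.hat μ) (.hat ν)] at h2
  rw [ha (.hat μ) (.hat ν)]
  linear_combination -x μ p * h1 - x ν p * h2

theorem IsCanonicalFrame.base_zero (hf : IsCanonicalFrame T h U e x Q Q₀) (hU : IsOpen U)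
    (hh : IsPrincipalKillingYano n T h) {p : M} (hp : p ∈ U)
    (v : TangentSpace I p) (μ : Fin n) :
    x μ p * connForm (nablaT T) e (.base μ) .zero p v =
      √(Q₀ p) * coframe e (.hat μ) p v - √(Q μ p) * coframe e .zero p v := by
  have h1 := hf.structure_eq hU hh hp v (.hat μ) .zero
  have ha := connForm_antisymm T hU hp hf.orthonormal (hf.mdiffAt hU hp)
  simp [hf.xi_zero hp, hf.xi_hat hp] at h1
  rw [ha .zero (.base μ)] at h1
  linear_combination h1

theorem IsCanonicalFrame.hat_zero (hf : IsCanonicalFrame T h U e x Q Q₀) (hU : IsOpen U)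
    (hh : IsPrincipalKillingYano n T h) {p : M} (hp : p ∈ U)
    (v : TangentSpace I p) (μ : Fin n) :
    x μ p * connForm (nablaT T) e (.hat μ) .zero p v =
      -√(Q₀ p) * coframe e (.base μ) p v := by
  have h1 := hf.structure_eq hU hh hp v (.base μ) .zero
  have ha := connForm_antisymm T hU hp hf.orthonormal (hf.mdiffAt hU hp)
  simp [hf.xi_zero hp, hf.xi_base hp] at h1
  rw [ha .zero (.hat μ)] at h1
  linear_combination -h1

theorem IsCanonicalFrame.base_hat (hf : IsCanonicalFrame T h U e x Q Q₀) (hU : IsOpen U)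
    (hh : IsPrincipalKillingYano n T h) {p : M} (hp : p ∈ U)
    (v : TangentSpace I p) (μ ν : Fin n) :
    (x μ p ^ 2 - x ν p ^ 2) * connForm (nablaT T) e (.base μ) (.hat ν) p v =
      x μ p * √(Q ν p) * coframe e (.hat μ) p v - x μ p * √(Q μ p) * coframe e (.hat ν) p v := by
  have h1 := hf.structure_eq hU hh hp v (.base μ) (.base ν)
  have h2 := hf.structure_eq hU hh hp v (.hat μ) (.hat ν)
  have ha := connForm_antisymm T hU hp hf.orthonormal (hf.mdiffAt hU hp)
  simp [hf.xi_base hp, hf.xi_hat hp, mul_sub, Finset.sum_sub_distrib] at h1 h2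
  rw [ha (.hat μ) (.base ν), ha (.hat ν) (.base μ)] at h2
  linear_combination x μ p * h2 + x ν p * h1

theorem IsCanonicalFrame.sq_sub_sq_ne_zero (hf : IsCanonicalFrame T h U e x Q Q₀) (hU : IsOpen U)
    (hh : IsPrincipalKillingYano n T h) {p : M} (hp : p ∈ U)
    (hE : Module.finrank ℝ E = 2 * n + 1) (μ ν : Fin n)
    (hμν : μ ≠ ν) : x μ p ^ 2 - x ν p ^ 2 ≠ 0 := by
  intro h0
  have h1 := hf.base_base hU hh hp (e (.base μ) p) μ ν hμν
  have hc (a b : FrameIdx n) : coframe e a p (e b p) = if a = b then (1 : ℝ) else 0 :=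
    hf.inner_eq hp a b
  have hQ : √(Q ν p) ≠ 0 := (Real.sqrt_ne_zero (hf.Q_nonneg p hp ν)).2 (hf.Q_ne_zero hU hh hp ν)
  have hx : x ν p ≠ 0 := coeff_ne_zero (hf.orthonormal p hp) (hf.darboux p hp) hE
    (hh.nondegenerate.rank_eq p) ν
  simp [h0, hc, hμν.symm, hx, hQ] at h1

/-- `√Q_μ ω^μ_μ̂ = κ^μ - ∑_{ν ≠ μ} √Q_ν ω^μ_ν̂ - √Q_0 ω^μ_0`. -/
theorem IsCanonicalFrame.base_hat_self (hf : IsCanonicalFrame T h U e x Q Q₀) (hU : IsOpen U) {p : M} (hp : p ∈ U)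
    (a : FrameIdx n) (μ : Fin n) :
    √(Q μ p) * connForm (nablaT T) e (.base μ) (.hat μ) p (e a p) = kappa T h e a (.base μ) p
      - ∑ ν ∈ Finset.univ.erase μ, √(Q ν p) * connForm (nablaT T) e (.base μ) (.hat ν) p (e a p)
      - √(Q₀ p) * connForm (nablaT T) e (.base μ) .zero p (e a p) := by
  have ha := connForm_antisymm T hU hp hf.orthonormal (hf.mdiffAt hU hp)
  rw [hf.kappa_base hU hp, ← Finset.add_sum_erase _ _ (Finset.mem_univ μ), ha .zero]
  simp only [ha (.hat _) (.base μ), mul_neg, Finset.sum_neg_distrib]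
  ring

/-- Continuous linear functionals that agree on a canonical frame are equal. -/
theorem IsCanonicalFrame.ext_frame (hf : IsCanonicalFrame T h U e x Q Q₀) {p : M} (hp : p ∈ U)
    (hE : Module.finrank ℝ E = 2 * n + 1)
    {α β : TangentSpace I p →L[ℝ] ℝ} (hαβ : ∀ a, α (e a p) = β (e a p)) : α = β := by
  have hcard : Fintype.card (FrameIdx n) = Module.finrank ℝ (TangentSpace I p) := by
    refine Eq.trans ?_ hE.symm
    simp only [Fintype.card_sum, Fintype.card_fin, Fintype.card_unit]
    ring
  have hb := coe_basisOfLinearIndependentOfCardEqFinrank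
    (hf.orthonormal p hp).linearIndependent hcard
  refine ContinuousLinearMap.coe_injective
    ((basisOfLinearIndependentOfCardEqFinrank
      (hf.orthonormal p hp).linearIndependent hcard).ext fun a => ?_)
  rw [hb]
  exact hαβ a

end CanonicalFrame

end TorsionKY

theorem lemma4p1 (n : ℕ) {M : Type*} [TopologicalSpace M]
    [ChartedSpace (EuclideanSpace ℝ (Fin (2 * n + 1))) M]
    [IsManifold (𝓡 (2 * n + 1)) ∞ M]
    [RiemannianBundle (fun p : M => TangentSpace (𝓡 (2 * n + 1)) p)]
    [IsContMDiffRiemannianBundle (𝓡 (2 * n + 1)) ∞ (EuclideanSpace ℝ (Fin (2 * n + 1)))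
      (fun p : M => TangentSpace (𝓡 (2 * n + 1)) p)]
    (T : FormField (𝓡 (2 * n + 1)) M 3) (hT : T.IsSmooth)
    (h : FormField (𝓡 (2 * n + 1)) M 2) (hh : IsPrincipalKillingYano n T h)
    (U : Set M) (hU : IsOpen U)
    (e : FrameIdx n → Π p : M, TangentSpace (𝓡 (2 * n + 1)) p)
    (x Q : Fin n → M → ℝ) (Q₀ : M → ℝ)
    (hframe : IsCanonicalFrame T h U e x Q Q₀) (hQ₀ : ∀ p ∈ U, Q₀ p ≠ 0) :
    ∀ p ∈ U,
      (∀ μ, Q μ p ≠ 0 ∧ x μ p ≠ 0) ∧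
      (∀ μ ν, μ ≠ ν → x μ p ^ 2 - x ν p ^ 2 ≠ 0) ∧
      (∀ μ ν, μ ≠ ν → connForm (nablaT T) e (.base μ) (.base ν) p =
        -(x ν p * √(Q ν p) / (x μ p ^ 2 - x ν p ^ 2)) • coframe e (.base μ) p
          - (x μ p * √(Q μ p) / (x μ p ^ 2 - x ν p ^ 2)) • coframe e (.base ν) p) ∧
      (∀ μ, connForm (nablaT T) e (.base μ) (.hat μ) p =
        -(1 / √(Q μ p) * ((∑ ν ∈ Finset.univ.erase μ,
            x μ p * Q ν p / (x μ p ^ 2 - x ν p ^ 2)) + Q₀ p / x μ p)) • coframe e (.hat μ) p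
          + (∑ ν ∈ Finset.univ.erase μ,
            (x μ p * √(Q ν p) / (x μ p ^ 2 - x ν p ^ 2)) • coframe e (.hat ν) p)
          + (√(Q₀ p) / x μ p) • coframe e .zero p
          + ∑ a, (kappa T h e a (.base μ) p / √(Q μ p)) • coframe e a p) ∧
      (∀ μ ν, μ ≠ ν → connForm (nablaT T) e (.base μ) (.hat ν) p =
        (x μ p * √(Q ν p) / (x μ p ^ 2 - x ν p ^ 2)) • coframe e (.hat μ) p
          - (x μ p * √(Q μ p) / (x μ p ^ 2 - x ν p ^ 2)) • coframe e (.hat ν) p) ∧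
      (∀ μ ν, μ ≠ ν → connForm (nablaT T) e (.hat μ) (.hat ν) p =
        -(x μ p * √(Q ν p) / (x μ p ^ 2 - x ν p ^ 2)) • coframe e (.base μ) p
          - (x ν p * √(Q μ p) / (x μ p ^ 2 - x ν p ^ 2)) • coframe e (.base ν) p) ∧
      (∀ μ, connForm (nablaT T) e (.base μ) .zero p =
        (√(Q₀ p) / x μ p) • coframe e (.hat μ) p
          - (√(Q μ p) / x μ p) • coframe e .zero p) ∧
      (∀ μ, connForm (nablaT T) e (.hat μ) .zero p =
        -(√(Q₀ p) / x μ p) • coframe e (.base μ) p) := by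
  intro p hp
  have hE : Module.finrank ℝ (EuclideanSpace ℝ (Fin (2 * n + 1))) = 2 * n + 1 := by simp
  have hx (μ) : x μ p ≠ 0 := coeff_ne_zero (hframe.orthonormal p hp) (hframe.darboux p hp) hE
    (hh.nondegenerate.rank_eq p) μ
  have hQ (μ) : Q μ p ≠ 0 := hframe.Q_ne_zero hU hh hp μ
  have hs (μ) : √(Q μ p) ≠ 0 := (Real.sqrt_ne_zero (hframe.Q_nonneg p hp μ)).2 (hQ μ)
  have hd (μ ν) (hμν : μ ≠ ν) : x μ p ^ 2 - x ν p ^ 2 ≠ 0 :=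
    hframe.sq_sub_sq_ne_zero hU hh hp hE μ ν hμν
  have hbh (v) (μ ν : Fin n) (hμν : μ ≠ ν) : connForm (nablaT T) e (.base μ) (.hat ν) p v =
      x μ p * √(Q ν p) / (x μ p ^ 2 - x ν p ^ 2) * coframe e (.hat μ) p v
        - x μ p * √(Q μ p) / (x μ p ^ 2 - x ν p ^ 2) * coframe e (.hat ν) p v := by
    have h1 := hframe.base_hat hU hh hp v μ ν
    have := hd μ ν hμν
    field_simp
    linear_combination h1
  have hbz (v) (μ) : connForm (nablaT T) e (.base μ) .zero p v =
      √(Q₀ p) / x μ p * coframe e (.hat μ) p v - √(Q μ p) / x μ p * coframe e .zero p v := by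
    have h1 := hframe.base_zero hU hh hp v μ
    have := hx μ
    field_simp
    linear_combination h1
  refine ⟨fun μ => ⟨hQ μ, hx μ⟩, hd, fun μ ν hμν => ?_, fun μ => ?_, fun μ ν hμν => ?_,
    fun μ ν hμν => ?_, fun μ => ?_, fun μ => ?_⟩
  · ext v
    have h1 := hframe.base_base hU hh hp v μ ν hμν
    have := hd μ ν hμν
    simp only [sub_apply, smul_apply, smul_eq_mul]
    field_simp
    linear_combination h1
  · refine hframe.ext_frame hp hE fun a => ?_
    have h1 := hframe.base_hat_self hU hp a μ
    have h2 : ∑ b, kappa T h e b (.base μ) p / √(Q μ p) * coframe e b p (e a p) =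
        kappa T h e a (.base μ) p / √(Q μ p) := by
      have hc (b : FrameIdx n) : coframe e b p (e a p) = if b = a then (1 : ℝ) else 0 :=
        hframe.inner_eq hp b a
      simp [hc]
    have h3 : ∑ ν ∈ Finset.univ.erase μ,
          √(Q ν p) * connForm (nablaT T) e (.base μ) (.hat ν) p (e a p) =
        (∑ ν ∈ Finset.univ.erase μ, x μ p * Q ν p / (x μ p ^ 2 - x ν p ^ 2)) *
            coframe e (.hat μ) p (e a p)
          - √(Q μ p) * ∑ ν ∈ Finset.univ.erase μ,
            x μ p * √(Q ν p) / (x μ p ^ 2 - x ν p ^ 2) * coframe e (.hat ν) p (e a p) := by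
      rw [Finset.sum_mul, Finset.mul_sum, ← Finset.sum_sub_distrib]
      refine Finset.sum_congr rfl fun ν hν => ?_
      rw [hbh _ μ ν (Finset.ne_of_mem_erase hν).symm]
      linear_combination x μ p / (x μ p ^ 2 - x ν p ^ 2) * coframe e (.hat μ) p (e a p) *
        Real.mul_self_sqrt (hframe.Q_nonneg p hp ν)
    simp only [add_apply, FunLike.coe_sum, Finset.sum_apply, smul_apply, smul_eq_mul, h2]
    rw [h3, hbz] at h1
    have h4 := Real.mul_self_sqrt (hframe.Q₀_nonneg p hp)
    have h5 (A B c z k : ℝ) : k - (A * c - √(Q μ p) * B)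
          - √(Q₀ p) * (√(Q₀ p) / x μ p * c - √(Q μ p) / x μ p * z) =
        √(Q μ p) * (-(1 / √(Q μ p) * (A + Q₀ p / x μ p)) * c + B + √(Q₀ p) / x μ p * z
          + k / √(Q μ p)) := by
      have := hx μ
      have := hs μ
      field_simp
      linear_combination -c * h4
    exact mul_left_cancel₀ (hs μ) (h1.trans (h5 ..))
  · ext v
    simp only [sub_apply, smul_apply, smul_eq_mul]
    exact hbh v μ ν hμν
  · ext v
    have h1 := hframe.hat_hat hU hh hp v μ ν hμν
    have := hd μ ν hμν
    simp only [sub_apply, smul_apply, smul_eq_mul]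
    field_simp
    linear_combination h1
  · ext v
    simp only [sub_apply, smul_apply, smul_eq_mul]
    exact hbz v μ
  · ext v
    have h1 := hframe.hat_zero hU hh hp v μ
    have := hx μ
    simp only [smul_apply, smul_eq_mul]
    field_simp
    linear_combination h1
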